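/- An overpartition of $n$ is a partition of $n$ in which the first occurrence of each part may be overlined, and its Dyson rank is its largest part minus its number of parts (the rank of the empty overpartition is $0$). Let $\overline{N}(m,n)$ be the number of overpartitions of $n$ with Dyson rank $m$, and let $\overline{M}(m,n)$ be the residual crank numbers defined by the generating function $$\sum_{n\ge 0}\sum_{m\in\mathbb{Z}}\overline{M}(m,n)z^mq^n=\frac{(-q;q)_\infty(q;q)_\infty}{(zq;q)_\infty(z^{-1}q;q)_\infty},\qquad (a;q)_\infty=\prod_{j\ge 0}(1-aq^j).$$ For $k\ge 1$ define the symmetrized moments $$\overline{\eta}_{k}(n)=\sum_{m\in\mathbb{Z}}\binom{m+\lfloor\frac{k-1}{2}\rfloor}{k}\overline{N}(m,n),\qquad \overline{\mu}_{k}(n)=\sum_{m\in\mathbb{Z}}\binom{m+\lfloor\frac{k-1}{2}\rfloor}{k}\overline{M}(m,n),$$ where $\binom{x}{k}=x(x-1)\cdots(x-k+1)/k!$, and put $\overline{\mathrm{spt}}_k(n)=\overline{\mu}_{2k}(n)-\overline{\eta}_{2k}(n)$. Then for all $k\ge 1$, as formal power series in $q$, $$\sum_{n=1}^\infty\overline{\mathrm{spt}}_k(n)q^n=\sum_{n=1}^\infty\bigl(\overline{\mu}_{2k}(n)-\overline{\eta}_{2k}(n)\bigr)q^n=\sum_{n_k\ge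 n_{k-1}\ge\cdots\ge n_1\ge 1}\frac{q^{n_1+n_2+\cdots+n_k}}{(1-q^{n_k})^2(1-q^{n_{k-1}})^2\cdots(1-q^{n_1})^2}\,\frac{(-q^{n_1+1};q)_\infty}{(q^{n_1+1};q)_\infty}.$$ In particular, $\overline{\mathrm{spt}}_k(n)\ge 0$ for all $k\ge 1$ and $n\ge 1$. -/

import Mathlib

open PowerSeries
open scoped LaurentPolynomial
open scoped PowerSeries.WithPiTopology

/-- An overpartition of `n`: a partition of `n` in which the first occurrence of each part size
may be overlined; `overlined` is the set of part sizes whose first occurrence is overlined. -/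
structure Overpartition (n : ℕ) where
  toPartition : n.Partition
  overlined : Finset ℕ
  overlined_subset : overlined ⊆ toPartition.parts.toFinset

namespace Overpartition

/-- The Dyson rank: the largest part minus the number of parts (overlined parts are parts).
The empty overpartition has rank `0`. -/
def dysonRank {n : ℕ} (π : Overpartition n) : ℤ :=
  (π.toPartition.parts.sup : ℤ) - (Multiset.card π.toPartition.parts : ℤ)

instance instFinite (n : ℕ) : Finite (Overpartition n) := by
  let f : Overpartition n → (Σ p : n.Partition, p.parts.toFinset.powerset) := fun π =>
    ⟨π.toPartition, ⟨π.overlined, Finset.mem_powerset.2 π.overlined_subset⟩⟩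
  refine Finite.of_injective f ?_
  rintro ⟨p, s, hs⟩ ⟨p', s', hs'⟩ h
  simp only [f, Sigma.mk.injEq] at h
  obtain ⟨rfl, h⟩ := h
  simpa using h

end Overpartition

noncomputable section

/-- The `q`-Pochhammer product `(a; q)_∞ = ∏_{j ≥ 0} (1 - a q ^ j)` in a ring of formal power
series whose indeterminate is `q`. -/
def qPochInf {R : Type*} [CommRing R] [TopologicalSpace R] (a : R⟦X⟧) : R⟦X⟧ :=
  ∏' j : ℕ, (1 - a * X ^ j)

/-- The quotient `f / g` of formal power series, for `g` with constant coefficient `1`. -/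
def psDiv {R : Type*} [CommRing R] (f g : R⟦X⟧) : R⟦X⟧ :=
  f * invOfUnit g 1

/-- `N̄(m, n)`: the number of overpartitions of `n` with Dyson rank `m`. -/
def overN (m : ℤ) (n : ℕ) : ℤ :=
  (Nat.card {π : Overpartition n // π.dysonRank = m} : ℤ)

/-- The generating function of the residual crank of overpartitions,
`(-q; q)_∞ (q; q)_∞ / ((z q; q)_∞ (z⁻¹ q; q)_∞)`, as a power series in `q` whose coefficients are
Laurent polynomials in `z = T` over `ℤ` (a ring that is given the discrete topology). -/
def residualCrankSeries : ℤ[T;T⁻¹]⟦X⟧ :=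
  letI : TopologicalSpace ℤ[T;T⁻¹] := ⊥
  psDiv (qPochInf (-X) * qPochInf X)
    (qPochInf (C (LaurentPolynomial.T 1) * X) * qPochInf (C (LaurentPolynomial.T (-1)) * X))

/-- `M̄(m, n)`: the coefficient of `z ^ m q ^ n` in the generating function of the residual
crank. -/
def overM (m : ℤ) (n : ℕ) : ℤ :=
  (coeff n residualCrankSeries).coeff m

/-- The `k`-th symmetrized moment `∑_{m ∈ ℤ} binom (m + ⌊(k - 1) / 2⌋) k * a m` of a finitely
supported function `a` on the integers; the binomial coefficient `Ring.choose x k` is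
`x (x - 1) ⋯ (x - k + 1) / k!`, also for negative `x`. -/
def symmetrizedMoment (k : ℕ) (a : ℤ → ℤ) : ℤ :=
  ∑ᶠ m : ℤ, Ring.choose (m + ((k : ℤ) - 1) / 2) k * a m

/-- `η̄_k(n)`, the symmetrized rank moment. -/
def overEta (k n : ℕ) : ℤ := symmetrizedMoment k (fun m => overN m n)

/-- `μ̄_k(n)`, the symmetrized residual crank moment. -/
def overMu (k n : ℕ) : ℤ := symmetrizedMoment k (fun m => overM m n)

/-- The higher order smallest parts function `spt̄_k(n) = μ̄_{2k}(n) - η̄_{2k}(n)`. -/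
def sptBar (k n : ℕ) : ℤ := overMu (2 * k) n - overEta (2 * k) n

/-- The sums that define the rank moments are finite. -/
theorem overN_finite_support (n : ℕ) : (Function.support fun m => overN m n).Finite := by
  refine (Set.finite_range (fun π : Overpartition n => π.dysonRank)).subset ?_
  intro m hm
  by_contra hcon
  apply hm
  have : IsEmpty {π : Overpartition n // π.dysonRank = m} :=
    ⟨fun π => hcon ⟨π.1, π.2⟩⟩
  simp [overN]

/-- The sums that define the residual crank moments are finite. -/
theorem overM_finite_support (n : ℕ) : (Function.support fun m => overM m n).Finite :=
  (coeff n residualCrankSeries).coeff.hasFiniteSupport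

/-- The tuples `(n_1, …, n_k)` with `n_k ≥ n_{k-1} ≥ … ≥ n_1 ≥ 1`; the entry `n_i` is the value
at `i - 1 : Fin k`. -/
abbrev PosMonotoneTuple (k : ℕ) : Type :=
  {v : Fin k → ℕ // Monotone v ∧ ∀ i, 1 ≤ v i}

end

/-!
The symmetrized moments are the coefficients in an expansion in powers of `w = z + 1 / z - 2`: the
functional `L_k f = ∑ binom (m + k - 1) (2 k) f_m` on Laurent polynomials satisfies
`L_{k + 1} (w f) = L_k f`, and `L_{k + 1} 1 = 0` (`moment_succ_mul`, `moment_one`). It is applied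
coefficientwise in `q` to the generating functions of the residual crank and of the rank.

Write `x_n = q ^ n / (1 - q ^ n) ^ 2`. As
`(1 - z q ^ n) (1 - q ^ n / z) = (1 - q ^ n) ^ 2 - w q ^ n`,
the tails `P_n = ∏_{j > n} (1 - q ^ j) ^ 2 / ((1 - z q ^ j) (1 - q ^ j / z))` of the crank product
satisfy `P_n - P_{n + 1} = w x_{n + 1} P_n` (`crankTail_sub_succ`). Hence `L_k P_n` is the sum of
`x_{n_1} ⋯ x_{n_k}` over all `n < n_1 ≤ ⋯ ≤ n_k` (`hasSum_prod_lambertTerm`). With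
`d_n = (-q ^ (n + 1); q)_∞ / (q ^ (n + 1); q)_∞`, the multiple sum in question is therefore `L_k` of
`∑_{n ≥ 0} d_{n + 1} (P_n - P_{n + 1})`, and it remains to see that this series is the crank series
`d_0 P_0` minus the rank series (`hasSum_overTail_mul_crankTail_sub`).

Summation by parts turns it into `d_0 P_0 - 1 - ∑ (d_n - d_{n + 1}) P_n`. On the other hand, sorting
overpartitions by their largest part expresses the rank series as
`1 + 2 ∑_{m ≥ 0} z ^ m q ^ (m + 1) (-q / z; q)_m / (q / z; q)_{m + 1}` (`hasSum_rankTerm`). The two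
expressions agree by a case of Heine's transformation (`exists_hasSum_rankTerm_heineTerm`): both
evaluate one double series, by the `q`-binomial theorem (`hasSum_qBinomial`) in one index or in the
other. Nonnegativity holds because every summand of the multiple sum has nonnegative coefficients.
-/

/-! ### Formal power series: division and convergence -/

section Quotient

variable {R : Type*} [CommRing R] {f g h : R⟦X⟧}

theorem isUnit_of_constantCoeff_eq_one (hg : constantCoeff g = 1) : IsUnit g :=
  isUnit_iff_constantCoeff.2 (by simp [hg])

theorem psDiv_mul_cancel (f : R⟦X⟧) (hg : constantCoeff g = 1) : psDiv f g * g = f := by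
  rw [psDiv, mul_assoc, invOfUnit_mul _ _ (by simpa using hg), mul_one]

theorem psDiv_eq_of_eq_mul (hg : constantCoeff g = 1) (H : f = h * g) : psDiv f g = h := by
  refine (isUnit_of_constantCoeff_eq_one hg).mul_right_cancel ?_
  rw [psDiv_mul_cancel f hg, H]

theorem dvd_psDiv {a : R⟦X⟧} (H : a ∣ f) (g : R⟦X⟧) : a ∣ psDiv f g :=
  H.mul_right _

theorem map_psDiv {S : Type*} [CommRing S] (φ : R →+* S) (f : R⟦X⟧) (hg : constantCoeff g = 1) :
    map φ (psDiv f g) = psDiv (map φ f) (map φ g) := by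
  have h1 : constantCoeff (map φ g) = 1 := by
    rw [← coeff_zero_eq_constantCoeff_apply, coeff_map, coeff_zero_eq_constantCoeff_apply, hg,
      map_one]
  refine (psDiv_eq_of_eq_mul h1 ?_).symm
  rw [← map_mul, psDiv_mul_cancel f hg]

theorem psDiv_mul_psDiv {f' g' : R⟦X⟧} (hg : constantCoeff g = 1) (hg' : constantCoeff g' = 1) :
    psDiv f g * psDiv f' g' = psDiv (f * f') (g * g') := by
  refine (psDiv_eq_of_eq_mul (by simp [hg, hg']) ?_).symm
  linear_combination (-f') * psDiv_mul_cancel f hg - psDiv f g * g * psDiv_mul_cancel f' hg'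

theorem psDiv_eq_psDiv {f' g' : R⟦X⟧} (hg : constantCoeff g = 1) (hg' : constantCoeff g' = 1)
    (H : f * g' = f' * g) : psDiv f g = psDiv f' g' := by
  refine psDiv_eq_of_eq_mul hg ((isUnit_of_constantCoeff_eq_one hg').mul_right_cancel ?_)
  linear_combination H - g * psDiv_mul_cancel f' hg'

theorem constantCoeff_eq_one_of_X_pow_dvd {n : ℕ} (hn : n ≠ 0) (H : X ^ n ∣ g - 1) :
    constantCoeff g = 1 := by
  have := X_dvd_iff.1 ((dvd_pow_self X hn).trans H)
  simpa [sub_eq_zero] using this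

theorem constantCoeff_one_sub (H : X ∣ g) : constantCoeff (1 - g) = 1 := by
  simp [X_dvd_iff.1 H]

theorem eq_of_forall_X_pow_dvd_sub (H : ∀ n, X ^ n ∣ f - g) : f = g := by
  ext n
  simpa [sub_eq_zero] using X_pow_dvd_iff.1 (H (n + 1)) n n.lt_succ_self

theorem X_pow_dvd_mul_sub_one {n : ℕ} (hf : X ^ n ∣ f - 1) (hg : X ^ n ∣ g - 1) :
    X ^ n ∣ f * g - 1 := by
  have : f * g - 1 = (f - 1) * g + (g - 1) := by ring
  rw [this]
  exact dvd_add (hf.mul_right _) hg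

theorem X_pow_dvd_psDiv_sub_one {n : ℕ} (hn : n ≠ 0) (hf : X ^ n ∣ f - 1) (hg : X ^ n ∣ g - 1) :
    X ^ n ∣ psDiv f g - 1 := by
  have h1 := constantCoeff_eq_one_of_X_pow_dvd hn hg
  refine (isUnit_of_constantCoeff_eq_one h1).dvd_mul_right.1 ?_
  rw [sub_mul, psDiv_mul_cancel f h1, one_mul, ← sub_sub_sub_cancel_right f g 1]
  exact dvd_sub hf hg

end Quotient

section Convergence

variable {R : Type*} [CommRing R] [TopologicalSpace R]

theorem summable_of_finite_coeff_ne_zero {ι : Type*} {f : ι → R⟦X⟧}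
    (H : ∀ d, {i | coeff d (f i) ≠ 0}.Finite) : Summable f :=
  (WithPiTopology.summable_iff_summable_coeff R).2 fun d =>
    summable_of_hasFiniteSupport (H d)

theorem summable_of_X_pow_dvd {f : ℕ → R⟦X⟧} (H : ∀ n, X ^ n ∣ f n) : Summable f :=
  summable_of_finite_coeff_ne_zero fun d => (Set.finite_Iic d).subset fun n hn => by
    by_contra hlt
    exact hn (X_pow_dvd_iff.1 (H n) d (not_le.1 hlt))

theorem X_pow_dvd_of_hasSum [T2Space R] {ι : Type*} {f : ι → R⟦X⟧} {s : R⟦X⟧} {n : ℕ}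
    (hs : HasSum f s) (H : ∀ i, X ^ n ∣ f i) : X ^ n ∣ s := by
  refine X_pow_dvd_iff.2 fun m hm => ?_
  have h1 := (WithPiTopology.hasSum_iff_hasSum_coeff R).1 hs m
  have h2 : (fun i => coeff m (f i)) = fun _ => 0 :=
    funext fun i => X_pow_dvd_iff.1 (H i) m hm
  rw [h2] at h1
  exact h1.unique hasSum_zero

/-- A telescoping series whose terms tend to `1` in the `X`-adic sense. -/
theorem hasSum_sub_succ {u : ℕ → R⟦X⟧} (H : ∀ n, X ^ n ∣ u n - 1) :
    HasSum (fun n => u n - u (n + 1)) (u 0 - 1) := by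
  refine (WithPiTopology.hasSum_iff_hasSum_coeff R).2 fun d => ?_
  have h1 : ∀ n, d < n → coeff d (u n - 1) = 0 := fun n hn => X_pow_dvd_iff.1 (H n) d hn
  have h2 : coeff d (u 0 - 1) = ∑ n ∈ Finset.range (d + 1), coeff d (u n - u (n + 1)) := by
    rw [← map_sum, Finset.sum_range_sub']
    have := h1 (d + 1) d.lt_succ_self
    rw [map_sub, sub_eq_zero] at this
    rw [map_sub, map_sub, this]
  rw [h2]
  refine hasSum_sum_of_ne_finset_zero fun n hn => ?_
  have hn' : d < n := by simpa using hn
  rw [← sub_sub_sub_cancel_right (u n) _ 1, map_sub, h1 n hn', h1 (n + 1) (by omega), sub_zero]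

end Convergence

/-! ### `q`-Pochhammer products and the `q`-binomial theorem -/

/-- The finite `q`-Pochhammer product `(a; q)_n = ∏_{j < n} (1 - a q ^ j)`, where `q` is the
indeterminate. -/
noncomputable def qPoch {R : Type*} [CommRing R] (a : R⟦X⟧) (n : ℕ) : R⟦X⟧ :=
  ∏ j ∈ Finset.range n, (1 - a * X ^ j)

section Pochhammer

variable {R : Type*} [CommRing R]

@[simp]
theorem qPoch_zero (a : R⟦X⟧) : qPoch a 0 = 1 := by simp [qPoch]

theorem qPoch_succ (a : R⟦X⟧) (n : ℕ) : qPoch a (n + 1) = qPoch a n * (1 - a * X ^ n) :=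
  Finset.prod_range_succ _ _

theorem constantCoeff_qPoch {a : R⟦X⟧} (ha : X ∣ a) (n : ℕ) : constantCoeff (qPoch a n) = 1 := by
  rw [qPoch, map_prod]
  exact Finset.prod_eq_one fun j _ => constantCoeff_one_sub (ha.mul_right _)

theorem map_qPoch {S : Type*} [CommRing S] (φ : R →+* S) (a : R⟦X⟧) (n : ℕ) :
    map φ (qPoch a n) = qPoch (map φ a) n := by
  simp [qPoch, map_prod]

variable [TopologicalSpace R]

theorem multipliable_qPochInf (a : R⟦X⟧) : Multipliable fun j : ℕ => 1 - a * X ^ j := by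
  simp_rw [sub_eq_add_neg]
  apply WithPiTopology.multipliable_one_add_of_tendsto_order_atTop_nhds_top
  refine ENat.tendsto_nhds_top_iff_natCast_lt.mpr fun n => Filter.eventually_atTop.mpr
    ⟨n + 1, fun m hm => ?_⟩
  rw [order_neg]
  refine lt_of_lt_of_le (Nat.cast_lt.2 hm) (nat_le_order _ _ fun i hi => ?_)
  exact X_pow_dvd_iff.1 (Dvd.intro_left a rfl) i hi

variable [T2Space R]

theorem X_pow_dvd_qPochInf_sub_one {a : R⟦X⟧} {n : ℕ} (ha : X ^ n ∣ a) :
    X ^ n ∣ qPochInf a - 1 := by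
  refine X_pow_dvd_iff.2 fun m hm => ?_
  have h1 := (multipliable_qPochInf a).hasProd
  rw [HasProd, WithPiTopology.tendsto_iff_coeff_tendsto] at h1
  have h2 : (fun s : Finset ℕ => coeff m (∏ j ∈ s, (1 - a * X ^ j))) =
      fun _ => coeff m (1 : R⟦X⟧) := by
    funext s
    have h3 : X ^ n ∣ ∏ j ∈ s, (1 - a * X ^ j) - 1 := by
      induction s using Finset.induction_on with
      | empty => simp
      | insert i s hi ih =>
        rw [Finset.prod_insert hi]
        refine X_pow_dvd_mul_sub_one ?_ ih
        simpa using ha.mul_right _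
    have := X_pow_dvd_iff.1 h3 m hm
    rwa [map_sub, sub_eq_zero] at this
  have h4 := h1 m
  rw [h2] at h4
  rw [map_sub, sub_eq_zero]
  exact tendsto_nhds_unique h4 tendsto_const_nhds

theorem constantCoeff_qPochInf {a : R⟦X⟧} (ha : X ∣ a) : constantCoeff (qPochInf a) = 1 :=
  constantCoeff_eq_one_of_X_pow_dvd one_ne_zero (X_pow_dvd_qPochInf_sub_one (by simpa using ha))

variable [IsTopologicalRing R]

theorem qPochInf_eq_qPoch_mul (a : R⟦X⟧) (n : ℕ) :
    qPochInf a = qPoch a n * qPochInf (a * X ^ n) := by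
  have h1 : (fun j : ℕ => 1 - a * X ^ n * X ^ j) = fun j => 1 - a * X ^ (j + n) := by
    funext j
    rw [pow_add]
    ring
  have h2 := multipliable_qPochInf (a * X ^ n)
  rw [h1] at h2
  have := h2.prod_mul_tprod_nat_mul' (f := fun j => 1 - a * X ^ j) (k := n)
  rw [qPochInf, qPochInf, h1, qPoch, ← this]

theorem qPochInf_eq_mul (a : R⟦X⟧) : qPochInf a = (1 - a) * qPochInf (a * X) := by
  simpa [qPoch] using qPochInf_eq_qPoch_mul a 1

theorem X_pow_dvd_qPochInf_sub_qPoch (a : R⟦X⟧) (n : ℕ) :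
    X ^ n ∣ qPochInf a - qPoch a n := by
  rw [qPochInf_eq_qPoch_mul a n, ← mul_sub_one]
  exact (X_pow_dvd_qPochInf_sub_one (Dvd.intro_left a rfl)).mul_left _

theorem map_qPochInf {S : Type*} [CommRing S] [TopologicalSpace S] [T2Space S]
    [IsTopologicalRing S] (φ : R →+* S) (a : R⟦X⟧) :
    map φ (qPochInf a) = qPochInf (map φ a) := by
  refine eq_of_forall_X_pow_dvd_sub fun n => ?_
  have h1 := _root_.map_dvd (map φ) (X_pow_dvd_qPochInf_sub_qPoch a n)
  have h2 := X_pow_dvd_qPochInf_sub_qPoch (map φ a) n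
  rw [map_sub, map_qPoch, map_pow, map_X] at h1
  simpa using dvd_sub h1 h2

/-- The `q`-binomial theorem `∑ (a; q)_n / (q; q)_n t ^ n = (a t; q)_∞ / (t; q)_∞`. The series
`F(t)` on the left satisfies `(1 - t) F(t) = (1 - a t) F(t q)`, and iterating this leaves the factor
`F(t q ^ n)`, which is `1` modulo `q ^ n`. -/
theorem hasSum_qBinomial (a : R⟦X⟧) {t : R⟦X⟧} (ht : X ∣ t) :
    HasSum (fun n => psDiv (qPoch a n) (qPoch X n) * t ^ n)
      (psDiv (qPochInf (a * t)) (qPochInf t)) := by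
  set β : ℕ → R⟦X⟧ := fun n => psDiv (qPoch a n) (qPoch X n) with hβ
  have hsum : ∀ s : R⟦X⟧, X ∣ s → Summable fun n => β n * s ^ n := fun s hs =>
    summable_of_X_pow_dvd fun n => (pow_dvd_pow_of_dvd hs n).mul_left _
  have hβ0 : β 0 = 1 := by
    simpa [hβ] using psDiv_eq_of_eq_mul (map_one _) (one_mul (1 : R⟦X⟧)).symm
  have hβs : ∀ n, β (n + 1) * (1 - X ^ (n + 1)) = β n * (1 - a * X ^ n) := by
    intro n
    have hc : ∀ m, constantCoeff (qPoch (X : R⟦X⟧) m) = 1 := constantCoeff_qPoch dvd_rfl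
    refine (isUnit_of_constantCoeff_eq_one (hc n)).mul_right_cancel ?_
    have h1 := psDiv_mul_cancel (qPoch a (n + 1)) (hc (n + 1))
    have h2 := psDiv_mul_cancel (qPoch a n) (hc n)
    rw [qPoch_succ X, qPoch_succ a] at h1
    simp only [hβ, qPoch_succ] at h1 ⊢
    linear_combination h1 - (1 - a * X ^ n) * h2
  set F : R⟦X⟧ → R⟦X⟧ := fun s => ∑' n, β n * s ^ n with hF
  have hrec : ∀ s, X ∣ s → (1 - s) * F s = (1 - a * s) * F (s * X) := by
    intro s hs
    have h1 := (hsum s hs).hasSum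
    have h2 := (hsum (s * X) (hs.mul_right _)).hasSum
    have h3 := (hasSum_nat_add_iff' 1).2 (h1.sub h2)
    have h4 := (h1.mul_left s).sub (h2.mul_left (a * s))
    have h5 : (fun n => s * (β n * s ^ n) - a * s * (β n * (s * X) ^ n)) =
        fun n => β (n + 1) * s ^ (n + 1) - β (n + 1) * (s * X) ^ (n + 1) := by
      funext n
      rw [mul_pow, mul_pow]
      linear_combination (-s ^ (n + 1)) * hβs n
    rw [h5] at h4
    have h6 := h3.unique h4
    simp only [Finset.range_one, Finset.sum_singleton, pow_zero, sub_self, sub_zero] at h6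
    linear_combination h6
  have hiter : ∀ n, qPoch t n * F t = qPoch (a * t) n * F (t * X ^ n) := by
    intro n
    induction n with
    | zero => simp
    | succ n ih =>
      have := hrec (t * X ^ n) (ht.mul_right _)
      rw [qPoch_succ, qPoch_succ, pow_succ, ← mul_assoc t]
      linear_combination (1 - t * X ^ n) * ih + qPoch (a * t) n * this
  have hFone : ∀ n, X ^ n ∣ F (t * X ^ n) - 1 := by
    intro n
    have hd : X ^ n ∣ t * X ^ n := Dvd.intro_left _ rfl
    have h1 := (hasSum_nat_add_iff' 1).2 (hsum (t * X ^ n) (ht.mul_right _)).hasSum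
    simp only [Finset.range_one, Finset.sum_singleton, pow_zero, hβ0, mul_one] at h1
    exact X_pow_dvd_of_hasSum h1 fun i => (hd.trans (dvd_pow_self _ (by simp))).mul_left _
  have hfinal : qPochInf (a * t) = F t * qPochInf t := by
    refine eq_of_forall_X_pow_dvd_sub fun n => ?_
    have h1 : qPochInf (a * t) - F t * qPochInf t =
        qPoch (a * t) n * ((qPochInf (a * t * X ^ n) - 1) -
          (F (t * X ^ n) * qPochInf (t * X ^ n) - 1)) := by
      rw [qPochInf_eq_qPoch_mul (a * t) n, qPochInf_eq_qPoch_mul t n]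
      linear_combination (-qPochInf (t * X ^ n)) * hiter n
    rw [h1]
    exact (dvd_sub (X_pow_dvd_qPochInf_sub_one (Dvd.intro_left _ rfl))
      (X_pow_dvd_mul_sub_one (hFone n)
        (X_pow_dvd_qPochInf_sub_one (Dvd.intro_left _ rfl)))).mul_left _
  rw [psDiv_eq_of_eq_mul (constantCoeff_qPochInf ht) hfinal]
  exact (hsum t ht).hasSum

end Pochhammer

/-! ### A case of Heine's transformation -/

section Heine

variable {R : Type*} [CommRing R] [TopologicalSpace R]

/-- The term `z ^ m q ^ (m + 1) (-q / z; q)_m / (q / z; q)_{m + 1}`, where `Z` stands for `z` and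
`Y` for `1 / z`. Twice this term is the generating function of the overpartitions with largest
part `m + 1`, in which `z` marks the rank. -/
noncomputable def rankTerm (Z Y : R⟦X⟧) (m : ℕ) : R⟦X⟧ :=
  psDiv (Z ^ m * X ^ (m + 1) * qPoch (-(Y * X)) m) (qPoch (Y * X) (m + 1))

/-- The term `q ^ (n + 1) (-q ^ (n + 2); q)_∞ (q ^ (n + 1); q)_∞ / ((z q ^ (n + 1); q)_∞
(q ^ (n + 1) / z; q)_∞)`, where `Z` stands for `z` and `Y` for `1 / z`. -/
noncomputable def heineTerm (Z Y : R⟦X⟧) (n : ℕ) : R⟦X⟧ :=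
  psDiv (X ^ (n + 1) * qPochInf (-X ^ (n + 2)) * qPochInf (X ^ (n + 1)))
    (qPochInf (Z * X ^ (n + 1)) * qPochInf (Y * X ^ (n + 1)))

variable [T2Space R] [IsTopologicalRing R]

/-- Heine's transformation, in the case that is needed: expanding a suitable double series by the
`q`-binomial theorem in one index or in the other gives the two sides. -/
theorem exists_hasSum_rankTerm_heineTerm {Z Y : R⟦X⟧} (h : Z * Y = 1) :
    ∃ S, HasSum (rankTerm Z Y) S ∧ HasSum (heineTerm Z Y) S := by
  have hX : ∀ n, (X : R⟦X⟧) ∣ X ^ (n + 1) := fun n => dvd_pow_self _ n.succ_ne_zero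
  have hYX : (X : R⟦X⟧) ∣ Y * X := Dvd.intro_left _ rfl
  -- The double series `K ∑ a_m b_n z ^ m q ^ ((m + 1) (n + 1))`, with `a_m` and `b_n` the
  -- coefficients in the `q`-binomial theorem, is summed over `n` in `hrow` and over `m` in `hcol`.
  set K : R⟦X⟧ := psDiv (qPochInf X) (qPochInf (Y * X)) with hK
  set a : ℕ → R⟦X⟧ := fun m => psDiv (qPoch (-(Y * X)) m) (qPoch X m) with ha
  set b : ℕ → R⟦X⟧ := fun n => psDiv (qPoch (Y * X) n) (qPoch X n) with hb
  set D : ℕ × ℕ → R⟦X⟧ := fun p =>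
    K * (a p.1 * b p.2 * Z ^ p.1) * X ^ ((p.1 + 1) * (p.2 + 1)) with hD
  have hDsum : Summable D := by
    refine summable_of_finite_coeff_ne_zero fun d =>
      ((Set.finite_Iic d).prod (Set.finite_Iic d)).subset fun p hp => ?_
    by_contra hcon
    refine hp (X_pow_dvd_iff.1 (Dvd.intro_left _ rfl) d (?_ : d < (p.1 + 1) * (p.2 + 1)))
    rw [Set.mem_prod, Set.mem_Iic, Set.mem_Iic, not_and_or, not_le, not_le] at hcon
    rcases hcon with hcon | hcon <;> nlinarith
  have hrow : ∀ m, HasSum (fun n => D (m, n)) (rankTerm Z Y m) := by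
    intro m
    have h1 := (hasSum_qBinomial (Y * X) (hX m)).mul_left (K * (a m * Z ^ m) * X ^ (m + 1))
    have h2 : (fun n => K * (a m * Z ^ m) * X ^ (m + 1) *
        (psDiv (qPoch (Y * X) n) (qPoch X n) * (X ^ (m + 1)) ^ n)) = fun n => D (m, n) := by
      funext n
      simp only [hD, hb]
      ring
    rw [h2] at h1
    have c1 := constantCoeff_qPochInf (R := R) (hX m)
    have c2 : constantCoeff (qPochInf (Y * X * X ^ (m + 1))) = 1 :=
      constantCoeff_qPochInf ((hX m).mul_left _)
    have c3 := constantCoeff_qPoch (R := R) dvd_rfl m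
    have c4 := constantCoeff_qPoch hYX (m + 1)
    have e1 := qPochInf_eq_qPoch_mul (X : R⟦X⟧) m
    rw [← pow_succ'] at e1
    have e2 := qPochInf_eq_qPoch_mul (Y * X) (m + 1)
    have e3 : K * (a m * Z ^ m) * X ^ (m + 1) * psDiv (qPochInf (Y * X * X ^ (m + 1)))
        (qPochInf (X ^ (m + 1))) = Z ^ m * X ^ (m + 1) *
          (K * a m * psDiv (qPochInf (Y * X * X ^ (m + 1))) (qPochInf (X ^ (m + 1)))) := by ring
    rw [e3] at h1
    suffices key : rankTerm Z Y m = Z ^ m * X ^ (m + 1) *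
        (K * a m * psDiv (qPochInf (Y * X * X ^ (m + 1))) (qPochInf (X ^ (m + 1)))) by
      rw [key]
      exact h1
    rw [hK, ha, e1, e2, psDiv_mul_psDiv (by simp [c2, c4]) c3,
      psDiv_mul_psDiv (by simp [c2, c3, c4]) c1, psDiv, ← mul_assoc, rankTerm]
    refine psDiv_eq_psDiv c4 (by simp [c1, c2, c3, c4]) ?_
    ring
  have hcol : ∀ n, HasSum (fun m => D (m, n)) (heineTerm Z Y n) := by
    intro n
    have h1 := (hasSum_qBinomial (-(Y * X)) ((hX n).mul_left Z)).mul_left (K * b n * X ^ (n + 1))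
    have h2 : (fun m => K * b n * X ^ (n + 1) *
        (psDiv (qPoch (-(Y * X)) m) (qPoch X m) * (Z * X ^ (n + 1)) ^ m)) =
          fun m => D (m, n) := by
      funext m
      simp only [hD, ha]
      ring
    rw [h2] at h1
    have e0 : -(Y * X) * (Z * X ^ (n + 1)) = -X ^ (n + 2) := by
      linear_combination (-X ^ (n + 2)) * h
    have c1 := constantCoeff_qPochInf ((hX n).mul_left Z)
    have c2 := constantCoeff_qPochInf ((hX n).mul_left Y)
    have c3 := constantCoeff_qPoch (R := R) dvd_rfl n
    have c4 := constantCoeff_qPoch hYX n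
    have e1 := qPochInf_eq_qPoch_mul (X : R⟦X⟧) n
    rw [← pow_succ'] at e1
    have e2 := qPochInf_eq_qPoch_mul (Y * X) n
    rw [mul_assoc Y, ← pow_succ'] at e2
    have e3 : K * b n * X ^ (n + 1) * psDiv (qPochInf (-X ^ (n + 2)))
        (qPochInf (Z * X ^ (n + 1))) = X ^ (n + 1) *
          (K * b n * psDiv (qPochInf (-X ^ (n + 2))) (qPochInf (Z * X ^ (n + 1)))) := by ring
    rw [e0, e3] at h1
    suffices key : heineTerm Z Y n = X ^ (n + 1) *
        (K * b n * psDiv (qPochInf (-X ^ (n + 2))) (qPochInf (Z * X ^ (n + 1)))) by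
      rw [key]
      exact h1
    rw [hK, hb, e1, e2, psDiv_mul_psDiv (by simp [c2, c4]) c3,
      psDiv_mul_psDiv (by simp [c2, c3, c4]) c1, psDiv, ← mul_assoc, heineTerm]
    refine psDiv_eq_psDiv (by simp [c1, c2]) (by simp [c1, c2, c3, c4]) ?_
    ring
  refine ⟨∑' p, D p, hDsum.hasSum.prod_fiberwise hrow, ?_⟩
  exact ((Equiv.prodComm ℕ ℕ).hasSum_iff.2 hDsum.hasSum).prod_fiberwise hcol

end Heine

/-! ### Tails of the crank product -/

section Tails

variable {R : Type*} [CommRing R]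

/-- The series `q ^ n / (1 - q ^ n) ^ 2`. -/
noncomputable def lambertTerm (R : Type*) [CommRing R] (n : ℕ) : R⟦X⟧ :=
  psDiv (X ^ n) ((1 - X ^ n) ^ 2)

theorem lambertTerm_mul {n : ℕ} (hn : n ≠ 0) :
    lambertTerm R n * (1 - X ^ n) ^ 2 = X ^ n :=
  psDiv_mul_cancel _ (by rw [map_pow, constantCoeff_one_sub (dvd_pow_self _ hn), one_pow])

theorem X_pow_dvd_lambertTerm (n : ℕ) : X ^ n ∣ lambertTerm R n :=
  dvd_psDiv dvd_rfl _

variable [TopologicalSpace R]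

/-- The quotient `(-q ^ (n + 1); q)_∞ / (q ^ (n + 1); q)_∞`: the generating function of the
overpartitions into parts greater than `n`. -/
noncomputable def overTail (R : Type*) [CommRing R] [TopologicalSpace R] (n : ℕ) : R⟦X⟧ :=
  psDiv (qPochInf (-X ^ (n + 1))) (qPochInf (X ^ (n + 1)))

/-- The quotient `(q ^ (n + 1); q)_∞ ^ 2 / ((z q ^ (n + 1); q)_∞ (q ^ (n + 1) / z; q)_∞)`, where `Z`
stands for `z` and `Y` for `1 / z`. -/
noncomputable def crankTail (Z Y : R⟦X⟧) (n : ℕ) : R⟦X⟧ :=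
  psDiv (qPochInf (X ^ (n + 1)) ^ 2) (qPochInf (Z * X ^ (n + 1)) * qPochInf (Y * X ^ (n + 1)))

variable [T2Space R]

theorem X_pow_dvd_overTail_sub_one (n : ℕ) : X ^ (n + 1) ∣ overTail R n - 1 :=
  X_pow_dvd_psDiv_sub_one n.succ_ne_zero (X_pow_dvd_qPochInf_sub_one (dvd_neg.2 dvd_rfl))
    (X_pow_dvd_qPochInf_sub_one dvd_rfl)

theorem X_pow_dvd_crankTail_sub_one (Z Y : R⟦X⟧) (n : ℕ) : X ^ (n + 1) ∣ crankTail Z Y n - 1 := by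
  refine X_pow_dvd_psDiv_sub_one n.succ_ne_zero ?_ (X_pow_dvd_mul_sub_one
    (X_pow_dvd_qPochInf_sub_one (Dvd.intro_left _ rfl))
    (X_pow_dvd_qPochInf_sub_one (Dvd.intro_left _ rfl)))
  rw [sq]
  exact X_pow_dvd_mul_sub_one (X_pow_dvd_qPochInf_sub_one dvd_rfl)
    (X_pow_dvd_qPochInf_sub_one dvd_rfl)

variable [IsTopologicalRing R]

/-- The quotient of two consecutive tails is `1 - w q ^ n / (1 - q ^ n) ^ 2` with
`w = z + 1 / z - 2`, because `(1 - z q ^ n) (1 - q ^ n / z) = (1 - q ^ n) ^ 2 - w q ^ n`. -/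
theorem crankTail_sub_succ {Z Y : R⟦X⟧} (h : Z * Y = 1) (n : ℕ) :
    crankTail Z Y n - crankTail Z Y (n + 1) =
      (Z + Y - 2) * lambertTerm R (n + 1) * crankTail Z Y n := by
  have hX : ∀ n, (X : R⟦X⟧) ∣ X ^ (n + 1) := fun n => dvd_pow_self _ n.succ_ne_zero
  have c1 := constantCoeff_qPochInf ((hX (n + 1)).mul_left Z)
  have c2 := constantCoeff_qPochInf ((hX (n + 1)).mul_left Y)
  have c3 : constantCoeff ((1 - X ^ (n + 1) : R⟦X⟧) ^ 2) = 1 := by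
    rw [map_pow, constantCoeff_one_sub (hX n), one_pow]
  have c4 := constantCoeff_one_sub ((hX n).mul_left Z)
  have c5 := constantCoeff_one_sub ((hX n).mul_left Y)
  have e1 := qPochInf_eq_mul (X ^ (n + 1) : R⟦X⟧)
  have e2 := qPochInf_eq_mul (Z * X ^ (n + 1))
  have e3 := qPochInf_eq_mul (Y * X ^ (n + 1))
  rw [mul_assoc, ← pow_succ] at e2 e3
  rw [← pow_succ] at e1
  have f1 : crankTail Z Y n * ((1 - Z * X ^ (n + 1)) * (1 - Y * X ^ (n + 1))) =
      crankTail Z Y (n + 1) * (1 - X ^ (n + 1)) ^ 2 := by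
    refine (isUnit_of_constantCoeff_eq_one (g := qPochInf (Z * X ^ (n + 1 + 1)) *
      qPochInf (Y * X ^ (n + 1 + 1))) (by simp [c1, c2])).mul_right_cancel ?_
    have g1 : crankTail Z Y n * (qPochInf (Z * X ^ (n + 1)) * qPochInf (Y * X ^ (n + 1))) =
        qPochInf (X ^ (n + 1)) ^ 2 := psDiv_mul_cancel _ (by
      rw [e2, e3]
      simp only [map_mul, c1, c2, c4, c5, mul_one])
    have g2 : crankTail Z Y (n + 1) * (qPochInf (Z * X ^ (n + 1 + 1)) *
        qPochInf (Y * X ^ (n + 1 + 1))) = qPochInf (X ^ (n + 1 + 1)) ^ 2 :=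
      psDiv_mul_cancel _ (by simp [c1, c2])
    rw [e1, e2, e3] at g1
    linear_combination g1 - (1 - X ^ (n + 1)) ^ 2 * g2
  refine (isUnit_of_constantCoeff_eq_one c3).mul_right_cancel ?_
  linear_combination f1 -
    (Z + Y - 2) * crankTail Z Y n * lambertTerm_mul (R := R) (n := n + 1) n.succ_ne_zero -
    crankTail Z Y n * X ^ (n + 1) * X ^ (n + 1) * h

theorem overTail_sub_succ_mul_crankTail (Z Y : R⟦X⟧) (n : ℕ) :
    (overTail R n - overTail R (n + 1)) * crankTail Z Y n = 2 * heineTerm Z Y n := by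
  have hX : ∀ n, (X : R⟦X⟧) ∣ X ^ (n + 1) := fun n => dvd_pow_self _ n.succ_ne_zero
  have c1 := constantCoeff_qPochInf ((hX n).mul_left Z)
  have c2 := constantCoeff_qPochInf ((hX n).mul_left Y)
  have c3 := constantCoeff_qPochInf (R := R) (hX n)
  have c4 := constantCoeff_qPochInf (R := R) (hX (n + 1))
  have e1 := qPochInf_eq_mul (X ^ (n + 1) : R⟦X⟧)
  have e2 := qPochInf_eq_mul (-X ^ (n + 1) : R⟦X⟧)
  rw [neg_mul, ← pow_succ] at e2
  rw [← pow_succ] at e1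
  have c12 : constantCoeff (qPochInf (Z * X ^ (n + 1)) * qPochInf (Y * X ^ (n + 1))) = 1 := by
    simp [c1, c2]
  have g1 : overTail R n * qPochInf (X ^ (n + 1)) = qPochInf (-X ^ (n + 1)) :=
    psDiv_mul_cancel _ c3
  have g2 : overTail R (n + 1) * qPochInf (X ^ (n + 1 + 1)) = qPochInf (-X ^ (n + 1 + 1)) :=
    psDiv_mul_cancel _ c4
  have g3 : crankTail Z Y n * (qPochInf (Z * X ^ (n + 1)) * qPochInf (Y * X ^ (n + 1))) =
      qPochInf (X ^ (n + 1)) ^ 2 := psDiv_mul_cancel _ c12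
  have g4 : heineTerm Z Y n * (qPochInf (Z * X ^ (n + 1)) * qPochInf (Y * X ^ (n + 1))) =
      X ^ (n + 1) * qPochInf (-X ^ (n + 1 + 1)) * qPochInf (X ^ (n + 1)) :=
    psDiv_mul_cancel _ c12
  have g5 : (overTail R n - overTail R (n + 1)) * qPochInf (X ^ (n + 1)) =
      2 * X ^ (n + 1) * qPochInf (-X ^ (n + 1 + 1)) := by
    rw [sub_mul, g1, e1, e2]
    linear_combination (-(1 - X ^ (n + 1))) * g2
  refine (isUnit_of_constantCoeff_eq_one c12).mul_right_cancel ?_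
  linear_combination (overTail R n - overTail R (n + 1)) * g3 - 2 * g4 +
    qPochInf (X ^ (n + 1)) * g5

/-- The difference of the crank series `overTail R 0 * crankTail Z Y 0` and the rank series
`1 + 2 S` as one series, by summation by parts and Heine's transformation. -/
theorem hasSum_overTail_mul_crankTail_sub {Z Y S : R⟦X⟧} (h : Z * Y = 1)
    (hS : HasSum (rankTerm Z Y) S) :
    HasSum (fun n => overTail R (n + 1) * (crankTail Z Y n - crankTail Z Y (n + 1)))
      (overTail R 0 * crankTail Z Y 0 - (1 + 2 * S)) := by
  obtain ⟨S', hS', hH⟩ := exists_hasSum_rankTerm_heineTerm h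
  obtain rfl := hS.unique hS'
  have h1 := hasSum_sub_succ (u := fun n => overTail R n * crankTail Z Y n) fun n =>
    (pow_dvd_pow X n.le_succ).trans (X_pow_dvd_mul_sub_one (X_pow_dvd_overTail_sub_one n)
      (X_pow_dvd_crankTail_sub_one Z Y n))
  have h2 := h1.sub (hH.mul_left 2)
  have h3 : overTail R 0 * crankTail Z Y 0 - (1 + 2 * S) =
      overTail R 0 * crankTail Z Y 0 - 1 - 2 * S := by ring
  rw [h3]
  refine h2.congr_fun fun n => ?_
  linear_combination -overTail_sub_succ_mul_crankTail Z Y n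

end Tails

/-! ### The generating function of the Dyson rank -/

/-- The generating function of overpartitions in which each part of the underlying partition is
marked by `y` and the largest part by `z`; the power of `2` counts the ways to overline. -/
noncomputable def rankSeries {R : Type*} [CommRing R] (z y : R) : R⟦X⟧ :=
  PowerSeries.mk fun n => ∑ p : n.Partition,
    2 ^ p.parts.toFinset.card * y ^ Multiset.card p.parts * z ^ p.parts.sup

/-- The generating function of overpartitions into parts of size at most `N`, in which each part
is marked by `y`. -/
noncomputable def boundedSeries {R : Type*} [CommRing R] (y : R) (N : ℕ) : R⟦X⟧ :=
  Nat.Partition.genFun fun i c => if i ≤ N then 2 * y ^ c else 0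

section Rank

variable {R : Type*} [CommRing R]

theorem coeff_boundedSeries (y : R) (N n : ℕ) :
    coeff n (boundedSeries y N) = ∑ p : n.Partition, if p.parts.sup ≤ N then
      2 ^ p.parts.toFinset.card * y ^ Multiset.card p.parts else 0 := by
  rw [boundedSeries, Nat.Partition.coeff_genFun]
  refine Finset.sum_congr rfl fun p _ => ?_
  simp only [Finsupp.prod, Multiset.toFinsupp_support, Multiset.toFinsupp_apply]
  split_ifs with h
  · have h1 : ∀ i ∈ p.parts.toFinset, i ≤ N := fun i hi =>
      (Multiset.le_sup (Multiset.mem_toFinset.1 hi)).trans h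
    rw [Finset.prod_congr rfl fun i hi => if_pos (h1 i hi), Finset.prod_mul_distrib,
      Finset.prod_const, Finset.prod_pow_eq_pow_sum, Multiset.toFinset_sum_count_eq]
  · rw [Multiset.sup_le] at h
    push Not at h
    obtain ⟨i, hi, hiN⟩ := h
    exact Finset.prod_eq_zero (Multiset.mem_toFinset.2 hi) (if_neg (not_le.2 hiN))

variable [TopologicalSpace R] [T2Space R] [IsTopologicalRing R]

theorem boundedSeries_eq (y : R) (N : ℕ) :
    boundedSeries y N = psDiv (qPoch (-(C y * X)) N) (qPoch (C y * X) N) := by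
  have hX : (X : R⟦X⟧) ∣ C y * X := Dvd.intro_left _ rfl
  refine (psDiv_eq_of_eq_mul (constantCoeff_qPoch hX N) ?_).symm
  have h1 : ∀ i ∉ Finset.range N, 1 + ∑' j, (if i + 1 ≤ N then 2 * y ^ (j + 1) else 0) •
      (X : R⟦X⟧) ^ ((i + 1) * (j + 1)) = 1 := by
    intro i hi
    rw [Finset.mem_range] at hi
    simp [hi]
  have h2 := (Nat.Partition.hasProd_genFun fun i c => if i ≤ N then 2 * y ^ c else 0).unique
    (hasProd_prod_of_ne_finset_one h1)
  rw [boundedSeries, h2, qPoch, qPoch, ← Finset.prod_mul_distrib]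
  refine Finset.prod_congr rfl fun i hi => ?_
  have hi' : i + 1 ≤ N := Finset.mem_range.1 hi
  have ht : constantCoeff (C y * X ^ (i + 1)) = 0 := by simp
  have h3 : (fun j => (if i + 1 ≤ N then 2 * y ^ (j + 1) else 0) •
      (X : R⟦X⟧) ^ ((i + 1) * (j + 1))) =
        fun j => 2 * (C y * X ^ (i + 1)) * (C y * X ^ (i + 1)) ^ j := by
    funext j
    rw [if_pos hi', smul_eq_C_mul, map_mul, map_pow, map_ofNat, pow_mul]
    ring
  have h4 := WithPiTopology.tsum_pow_mul_one_sub_of_constantCoeff_eq_zero ht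
  rw [h3, (WithPiTopology.summable_pow_of_constantCoeff_eq_zero ht).tsum_mul_left]
  linear_combination (-2 * (C y * X ^ (i + 1))) * h4

theorem boundedSeries_succ_sub (z y : R) (N : ℕ) :
    C z ^ (N + 1) * (boundedSeries y (N + 1) - boundedSeries y N) =
      2 * (C z * C y) * rankTerm (C z) (C y) N := by
  have hX : (X : R⟦X⟧) ∣ C y * X := Dvd.intro_left _ rfl
  have c1 := constantCoeff_qPoch hX (N + 1)
  have g1 := psDiv_mul_cancel (qPoch (-(C y * X)) (N + 1)) c1
  have g2 := psDiv_mul_cancel (qPoch (-(C y * X)) N) (constantCoeff_qPoch hX N)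
  have g3 : rankTerm (C z) (C y) N * qPoch (C y * X) (N + 1) = _ := psDiv_mul_cancel _ c1
  rw [boundedSeries_eq, boundedSeries_eq]
  refine (isUnit_of_constantCoeff_eq_one c1).mul_right_cancel ?_
  rw [qPoch_succ (-_)] at g1
  have g4 : psDiv (qPoch (-(C y * X)) N) (qPoch (C y * X) N) * qPoch (C y * X) (N + 1) =
      qPoch (-(C y * X)) N * (1 - C y * X * X ^ N) := by
    rw [qPoch_succ, ← mul_assoc, g2]
  rw [qPoch_succ (-_)]
  linear_combination C z ^ (N + 1) * g1 - C z ^ (N + 1) * g4 - 2 * (C z * C y) * g3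

/-- Overpartitions are sorted by their largest part. -/
theorem hasSum_rankTerm {z y : R} (h : z * y = 1) :
    HasSum (fun N => 2 * rankTerm (C z) (C y) N) (rankSeries z y - 1) := by
  have h1 : ∀ N, 2 * rankTerm (C z) (C y) N =
      C z ^ (N + 1) * (boundedSeries y (N + 1) - boundedSeries y N) := fun N => by
    rw [boundedSeries_succ_sub, ← map_mul, h, map_one, mul_one]
  simp_rw [h1]
  refine (WithPiTopology.hasSum_iff_hasSum_coeff R).2 fun n => ?_
  have h2 : ∀ N, coeff n (C z ^ (N + 1) * (boundedSeries y (N + 1) - boundedSeries y N)) =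
      ∑ p : n.Partition, if N + 1 = p.parts.sup then
        2 ^ p.parts.toFinset.card * y ^ Multiset.card p.parts * z ^ p.parts.sup else 0 := by
    intro N
    rw [← map_pow, coeff_C_mul, map_sub, coeff_boundedSeries, coeff_boundedSeries,
      ← Finset.sum_sub_distrib, Finset.mul_sum]
    refine Finset.sum_congr rfl fun p _ => ?_
    rcases lt_trichotomy (N + 1) p.parts.sup with hlt | heq | hgt
    · rw [if_neg (by omega), if_neg (by omega), if_neg (by omega), sub_zero, mul_zero]
    · rw [if_pos (by omega), if_neg (by omega), if_pos heq, ← heq, sub_zero, mul_comm]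
    · rw [if_pos (by omega), if_pos (by omega), if_neg (by omega), sub_self, mul_zero]
  simp_rw [h2]
  have h3 : coeff n (rankSeries z y - 1) = ∑ p : n.Partition, if p.parts.sup = 0 then 0 else
      2 ^ p.parts.toFinset.card * y ^ Multiset.card p.parts * z ^ p.parts.sup := by
    -- Only the empty overpartition has no largest part; it accounts for the term `1`.
    have hsup : ∀ p : n.Partition, p.parts.sup = 0 ↔ n = 0 := by
      intro p
      constructor
      · intro hp
        have : p.parts = 0 := Multiset.eq_zero_of_forall_notMem fun i hi =>
          (p.parts_pos hi).ne' (Nat.le_zero.1 (hp ▸ Multiset.le_sup hi))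
        simpa [this] using p.parts_sum.symm
      · rintro rfl
        simp [Subsingleton.elim p default]
    simp_rw [hsup]
    rw [map_sub, rankSeries, coeff_mk, coeff_one]
    split_ifs with hn
    · subst hn
      simp
    · rw [sub_zero]
  rw [h3]
  refine hasSum_sum fun p _ => ?_
  rcases hs : p.parts.sup with _ | s
  · simp
  · simpa using hasSum_ite_eq s _

end Rank

theorem coeff_rankSeries_T (m : ℤ) (n : ℕ) :
    (coeff n (rankSeries (LaurentPolynomial.T 1 : ℤ[T;T⁻¹]) (LaurentPolynomial.T (-1)))).coeff m =
      overN m n := by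
  let e : {π : Overpartition n // π.dysonRank = m} ≃
      Σ p : {p : n.Partition // (p.parts.sup : ℤ) - (Multiset.card p.parts : ℤ) = m},
        p.1.parts.toFinset.powerset :=
    { toFun := fun π => ⟨⟨π.1.toPartition, π.2⟩,
        ⟨π.1.overlined, Finset.mem_powerset.2 π.1.overlined_subset⟩⟩
      invFun := fun q => ⟨⟨q.1.1, q.2.1, Finset.mem_powerset.1 q.2.2⟩, q.1.2⟩
      left_inv := fun _ => rfl
      right_inv := fun _ => rfl }
  have h1 : ∀ p : n.Partition, (2 ^ p.parts.toFinset.card *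
      (LaurentPolynomial.T (-1) : ℤ[T;T⁻¹]) ^ Multiset.card p.parts *
        LaurentPolynomial.T 1 ^ p.parts.sup).coeff m =
      if (p.parts.sup : ℤ) - (Multiset.card p.parts : ℤ) = m then
        2 ^ p.parts.toFinset.card else 0 := by
    intro p
    have h2 : (2 ^ p.parts.toFinset.card : ℤ[T;T⁻¹]) =
        LaurentPolynomial.C (2 ^ p.parts.toFinset.card) := by simp
    have h3 : (p.parts.sup : ℤ) - (Multiset.card p.parts : ℤ) =
        (Multiset.card p.parts : ℤ) * -1 + (p.parts.sup : ℤ) * 1 := by ring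
    rw [h2, LaurentPolynomial.T_pow, LaurentPolynomial.T_pow, mul_assoc, ← LaurentPolynomial.T_add,
      ← LaurentPolynomial.smul_eq_C_mul, AddMonoidAlgebra.coeff_smul, Finsupp.smul_apply,
      LaurentPolynomial.T_apply, h3, smul_eq_mul, mul_ite, mul_one, mul_one, mul_zero]
  have h4 : ∀ p : n.Partition, (Nat.card p.parts.toFinset.powerset : ℤ) =
      2 ^ p.parts.toFinset.card := by
    intro p
    rw [Nat.card_eq_fintype_card, Fintype.card_coe, Finset.card_powerset]
    push_cast
    rfl
  rw [rankSeries, coeff_mk, overN, Nat.card_congr e, Nat.card_sigma, AddMonoidAlgebra.coeff_sum,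
    Finset.sum_apply', Nat.cast_sum]
  simp_rw [h1, h4]
  rw [← Finset.sum_filter]
  exact Finset.sum_subtype _ (by simp) _

/-! ### Symmetrized moments as a linear functional -/

/-- The symmetrized moment of order `2 k` of the coefficients of a Laurent polynomial. On a
Laurent polynomial that is invariant under `z ↦ 1 / z` it is the coefficient of `w ^ k` in the
expansion in powers of `w = z + 1 / z - 2`. -/
noncomputable def moment (k : ℕ) : ℤ[T;T⁻¹] →+ ℤ where
  toFun f := symmetrizedMoment (2 * k) f.coeff
  map_zero' := by simp [symmetrizedMoment]
  map_add' f g := by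
    have h : ∀ f : ℤ[T;T⁻¹], (Function.support fun m : ℤ =>
        Ring.choose (m + (((2 * k : ℕ) : ℤ) - 1) / 2) (2 * k) * f.coeff m).Finite := fun f =>
      f.coeff.hasFiniteSupport.subset (Function.support_mul_subset_right _ _)
    rw [symmetrizedMoment, symmetrizedMoment, symmetrizedMoment, ← finsum_add_distrib (h f) (h g)]
    simp [mul_add]

theorem moment_C_mul_T (k : ℕ) (a m : ℤ) :
    moment k (LaurentPolynomial.C a * LaurentPolynomial.T m) =
      Ring.choose (m + (k - 1)) (2 * k) * a := by
  have h1 : ∀ i : ℤ, (LaurentPolynomial.C a * LaurentPolynomial.T m).coeff i =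
      if m = i then a else 0 := fun i => by
    rw [← LaurentPolynomial.smul_eq_C_mul, AddMonoidAlgebra.coeff_smul, Finsupp.smul_apply,
      LaurentPolynomial.T_apply, smul_eq_mul, mul_ite, mul_one, mul_zero]
  have h2 : (((2 * k : ℕ) : ℤ) - 1) / 2 = k - 1 := by omega
  change symmetrizedMoment _ _ = _
  rw [symmetrizedMoment, h2, finsum_eq_single _ m fun i hi => by rw [h1, if_neg hi.symm, mul_zero],
    h1, if_pos rfl]

theorem moment_one (k : ℕ) : moment k 1 = if k = 0 then 1 else 0 := by
  have h1 : (1 : ℤ[T;T⁻¹]) = LaurentPolynomial.C 1 * LaurentPolynomial.T 0 := by simp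
  rw [h1, moment_C_mul_T]
  rcases k with _ | k
  · simp
  · have h2 : (0 : ℤ) + (((k + 1 : ℕ) : ℤ) - 1) = (k : ℕ) := by
      push_cast
      ring
    rw [h2, Ring.choose_natCast, Nat.choose_eq_zero_of_lt (by omega)]
    simp

theorem T_add_T_sub_two_mul_C_mul_T (a m : ℤ) :
    (LaurentPolynomial.T 1 + LaurentPolynomial.T (-1) - 2) *
      (LaurentPolynomial.C a * LaurentPolynomial.T m : ℤ[T;T⁻¹]) =
    LaurentPolynomial.C a * LaurentPolynomial.T (m + 1) +
      LaurentPolynomial.C a * LaurentPolynomial.T (m - 1) -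
      (LaurentPolynomial.C a * LaurentPolynomial.T m +
        LaurentPolynomial.C a * LaurentPolynomial.T m) := by
  rw [LaurentPolynomial.T_add, LaurentPolynomial.T_sub]
  ring

theorem moment_zero_mul (f : ℤ[T;T⁻¹]) :
    moment 0 ((LaurentPolynomial.T 1 + LaurentPolynomial.T (-1) - 2) * f) = 0 := by
  induction f using LaurentPolynomial.induction_on' with
  | add p q hp hq => rw [mul_add, map_add, hp, hq, add_zero]
  | C_mul_T m a =>
    rw [T_add_T_sub_two_mul_C_mul_T, map_sub, map_add, map_add]
    simp only [moment_C_mul_T, mul_zero, Ring.choose_zero_right]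
    ring

/-- Multiplication by `w = z + 1 / z - 2` lowers the order of a symmetrized moment: the second
difference of a binomial coefficient is a binomial coefficient. -/
theorem moment_succ_mul (k : ℕ) (f : ℤ[T;T⁻¹]) :
    moment (k + 1) ((LaurentPolynomial.T 1 + LaurentPolynomial.T (-1) - 2) * f) = moment k f := by
  induction f using LaurentPolynomial.induction_on' with
  | add p q hp hq => rw [mul_add, map_add, map_add, hp, hq]
  | C_mul_T m a =>
    rw [T_add_T_sub_two_mul_C_mul_T, map_sub, map_add, map_add]
    simp only [moment_C_mul_T]
    set x : ℤ := m + (k - 1) with hx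
    have e1 : m + 1 + (((k + 1 : ℕ) : ℤ) - 1) = x + 1 + 1 := by
      push_cast
      ring
    have e2 : m - 1 + (((k + 1 : ℕ) : ℤ) - 1) = x := by
      push_cast
      ring
    have e3 : m + (((k + 1 : ℕ) : ℤ) - 1) = x + 1 := by
      push_cast
      ring
    rw [e1, e2, e3, show 2 * (k + 1) = 2 * k + 1 + 1 by ring, Ring.choose_succ_succ (x + 1),
      Ring.choose_succ_succ x, Ring.choose_succ_succ x]
    ring

/-- The symmetrized moment of order `2 k` with respect to `z`, coefficientwise in `q`. -/
noncomputable def momentSeries (k : ℕ) : ℤ[T;T⁻¹]⟦X⟧ →+ ℤ⟦X⟧ where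
  toFun f := PowerSeries.mk fun n => moment k (coeff n f)
  map_zero' := by
    ext n
    simp
  map_add' f g := by
    ext n
    simp

theorem coeff_momentSeries (k n : ℕ) (f : ℤ[T;T⁻¹]⟦X⟧) :
    coeff n (momentSeries k f) = moment k (coeff n f) := by
  simp [momentSeries]

theorem momentSeries_map_mul (k : ℕ) (g : ℤ⟦X⟧) (f : ℤ[T;T⁻¹]⟦X⟧) :
    momentSeries k (map (Int.castRingHom _) g * f) = g * momentSeries k f := by
  ext n
  simp only [coeff_momentSeries, coeff_mul, map_sum, coeff_map]
  refine Finset.sum_congr rfl fun p _ => ?_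
  rw [eq_intCast, ← zsmul_eq_mul, map_zsmul, smul_eq_mul]

theorem X_pow_dvd_momentSeries (k : ℕ) {n : ℕ} {f : ℤ[T;T⁻¹]⟦X⟧} (h : X ^ n ∣ f) :
    X ^ n ∣ momentSeries k f :=
  X_pow_dvd_iff.2 fun m hm => by rw [coeff_momentSeries, X_pow_dvd_iff.1 h m hm, map_zero]

theorem momentSeries_one (k : ℕ) : momentSeries k 1 = if k = 0 then 1 else 0 := by
  ext n
  rw [coeff_momentSeries, coeff_one]
  split_ifs with hn hk hk <;> simp [moment_one, coeff_one, hn, hk]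

theorem C_T_add_C_T_sub_two :
    C (LaurentPolynomial.T 1 : ℤ[T;T⁻¹]) + C (LaurentPolynomial.T (-1)) - 2 =
      C (LaurentPolynomial.T 1 + LaurentPolynomial.T (-1) - 2) := by
  rw [map_sub, map_add, map_ofNat]

theorem momentSeries_zero_mul (f : ℤ[T;T⁻¹]⟦X⟧) :
    momentSeries 0 ((C (LaurentPolynomial.T 1) + C (LaurentPolynomial.T (-1)) - 2) * f) = 0 := by
  ext n
  rw [C_T_add_C_T_sub_two, coeff_momentSeries, coeff_C_mul, moment_zero_mul, map_zero]

theorem momentSeries_succ_mul (k : ℕ) (f : ℤ[T;T⁻¹]⟦X⟧) :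
    momentSeries (k + 1) ((C (LaurentPolynomial.T 1) + C (LaurentPolynomial.T (-1)) - 2) * f) =
      momentSeries k f := by
  ext n
  rw [C_T_add_C_T_sub_two, coeff_momentSeries, coeff_C_mul, moment_succ_mul, coeff_momentSeries]

/-- The discrete topology on Laurent polynomials, as in the definition of the crank series. -/
local instance laurentTopologicalSpace : TopologicalSpace ℤ[T;T⁻¹] := ⊥

local instance laurentDiscreteTopology : DiscreteTopology ℤ[T;T⁻¹] := ⟨rfl⟩

theorem hasSum_momentSeries (k : ℕ) {ι : Type*} {f : ι → ℤ[T;T⁻¹]⟦X⟧} {s : ℤ[T;T⁻¹]⟦X⟧}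
    (h : HasSum f s) : HasSum (fun i => momentSeries k (f i)) (momentSeries k s) := by
  refine (WithPiTopology.hasSum_iff_hasSum_coeff ℤ).2 fun d => ?_
  simp only [coeff_momentSeries]
  exact ((WithPiTopology.hasSum_iff_hasSum_coeff _).1 h d).map (moment k)
    continuous_of_discreteTopology

theorem map_lambertTerm {n : ℕ} (hn : n ≠ 0) :
    map (Int.castRingHom ℤ[T;T⁻¹]) (lambertTerm ℤ n) = lambertTerm ℤ[T;T⁻¹] n := by
  rw [lambertTerm, map_psDiv _ _ (by
    rw [map_pow, constantCoeff_one_sub (dvd_pow_self _ hn), one_pow]), lambertTerm]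
  simp

theorem map_overTail (n : ℕ) :
    map (Int.castRingHom ℤ[T;T⁻¹]) (overTail ℤ n) = overTail ℤ[T;T⁻¹] n := by
  rw [overTail, map_psDiv _ _ (constantCoeff_qPochInf (dvd_pow_self _ n.succ_ne_zero)),
    map_qPochInf, map_qPochInf, overTail]
  simp

/-- The tail of the crank product at `z = T 1`. -/
noncomputable def laurentCrankTail (n : ℕ) : ℤ[T;T⁻¹]⟦X⟧ :=
  crankTail (C (LaurentPolynomial.T 1)) (C (LaurentPolynomial.T (-1))) n

theorem C_T_mul_C_T : C (LaurentPolynomial.T 1 : ℤ[T;T⁻¹]) * C (LaurentPolynomial.T (-1)) = 1 := by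
  rw [← map_mul, ← LaurentPolynomial.T_add]
  simp

theorem residualCrankSeries_eq :
    residualCrankSeries = overTail ℤ[T;T⁻¹] 0 * laurentCrankTail 0 := by
  have hX : (X : ℤ[T;T⁻¹]⟦X⟧) ∣ X ^ 1 := dvd_pow_self _ one_ne_zero
  have c1 := constantCoeff_qPochInf hX
  have c2 := constantCoeff_qPochInf (hX.mul_left (C (LaurentPolynomial.T 1)))
  have c3 := constantCoeff_qPochInf (hX.mul_left (C (LaurentPolynomial.T (-1))))
  rw [overTail, laurentCrankTail, crankTail, zero_add]
  simp only [pow_one] at c1 c2 c3 ⊢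
  rw [psDiv_mul_psDiv c1 (by simp [c2, c3])]
  refine psDiv_eq_psDiv (by simp [c2, c3]) (by simp [c1, c2, c3]) ?_
  ring

theorem momentSeries_map_mul_sub_succ (k n : ℕ) (g : ℤ⟦X⟧) :
    momentSeries (k + 1) (map (Int.castRingHom _) g *
      (laurentCrankTail n - laurentCrankTail (n + 1))) =
      g * lambertTerm ℤ (n + 1) * momentSeries k (laurentCrankTail n) := by
  rw [laurentCrankTail, laurentCrankTail, crankTail_sub_succ C_T_mul_C_T, momentSeries_map_mul,
    mul_assoc, momentSeries_succ_mul, ← map_lambertTerm n.succ_ne_zero, momentSeries_map_mul,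
    mul_assoc]

theorem hasSum_laurentCrankTail (n : ℕ) :
    HasSum (fun j => laurentCrankTail (n + j) - laurentCrankTail (n + j + 1))
      (laurentCrankTail n - 1) :=
  hasSum_sub_succ (u := fun j => laurentCrankTail (n + j)) fun j =>
    (pow_dvd_pow X (by omega)).trans (X_pow_dvd_crankTail_sub_one _ _ (n + j))

theorem momentSeries_zero_laurentCrankTail (n : ℕ) : momentSeries 0 (laurentCrankTail n) = 1 := by
  have h1 := hasSum_momentSeries 0 (hasSum_laurentCrankTail n)
  have h2 : (fun j => momentSeries 0 (laurentCrankTail (n + j) - laurentCrankTail (n + j + 1))) =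
      fun _ => 0 := by
    funext j
    rw [laurentCrankTail, laurentCrankTail, crankTail_sub_succ C_T_mul_C_T, mul_assoc,
      momentSeries_zero_mul]
  rw [h2, map_sub, momentSeries_one, if_pos rfl] at h1
  exact sub_eq_zero.1 (h1.unique hasSum_zero)

theorem hasSum_momentSeries_succ_laurentCrankTail (k n : ℕ) :
    HasSum (fun j => 1 * lambertTerm ℤ (n + 1 + j) * momentSeries k (laurentCrankTail (n + j)))
      (momentSeries (k + 1) (laurentCrankTail n)) := by
  have h1 := hasSum_momentSeries (k + 1) (hasSum_laurentCrankTail n)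
  rw [map_sub, momentSeries_one, if_neg k.succ_ne_zero, sub_zero] at h1
  refine h1.congr_fun fun j => ?_
  have h2 := momentSeries_map_mul_sub_succ k (n + j) 1
  rw [map_one, one_mul] at h2
  rw [h2, add_right_comm]

/-! ### Sums over monotone tuples -/

/-- The monotone tuples with entries at least `n`. -/
abbrev MonotoneTupleGE (k n : ℕ) : Type :=
  {v : Fin k → ℕ // Monotone v ∧ ∀ i, n ≤ v i}

/-- Monotone tuples are sorted by their first entry. -/
noncomputable def sigmaEquivMonotoneTupleGE (k n : ℕ) :
    (Σ j : ℕ, MonotoneTupleGE k (n + j)) ≃ MonotoneTupleGE (k + 1) n :=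
  Equiv.ofBijective
    (fun p => ⟨Fin.cons (n + p.1) p.2.1, by
      refine ⟨Fin.monotone_iff_le_succ.2 fun i => ?_, fun i => ?_⟩
      · rcases k with _ | k
        · exact i.elim0
        · induction i using Fin.cases with
          | zero => simpa using p.2.2.2 0
          | succ i =>
            rw [← Fin.succ_castSucc, Fin.cons_succ, Fin.cons_succ]
            exact p.2.2.1 (Fin.castSucc_le_succ i)
      · induction i using Fin.cases with
        | zero => simp
        | succ i => simpa using (Nat.le_add_right n p.1).trans (p.2.2.2 i)⟩) (by
    constructor
    · rintro ⟨j, w⟩ ⟨j', w'⟩ h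
      have h0 : (Fin.cons (n + j) w.1 : Fin (k + 1) → ℕ) = Fin.cons (n + j') w'.1 :=
        congrArg Subtype.val h
      have h1 := Fin.cons_inj.1 h0
      obtain rfl : j = j' := by
        have := h1.1
        omega
      rw [Subtype.ext h1.2]
    · rintro ⟨v, hv, hn⟩
      have h0 : n + (v 0 - n) = v 0 := by
        have := hn 0
        omega
      refine ⟨⟨v 0 - n, Fin.tail v, hv.comp (Fin.strictMono_succ).monotone, fun i => ?_⟩, ?_⟩
      · rw [h0]
        exact hv (Fin.zero_le _)
      · refine Subtype.ext ?_
        simp only [h0]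
        exact Fin.cons_self_tail v)

theorem coe_sigmaEquivMonotoneTupleGE (k n : ℕ) (p : Σ j : ℕ, MonotoneTupleGE k (n + j)) :
    (sigmaEquivMonotoneTupleGE k n p).1 = Fin.cons (n + p.1) p.2.1 :=
  rfl

theorem summable_prod_lambertTerm (k n : ℕ) (g : ℕ → ℤ⟦X⟧) :
    Summable fun v : MonotoneTupleGE (k + 1) n => g (v.1 0) * ∏ i, lambertTerm ℤ (v.1 i) := by
  refine summable_of_finite_coeff_ne_zero fun d => ?_
  refine Set.Finite.subset (((Set.finite_Iic fun _ : Fin (k + 1) => d).preimage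
    Subtype.val_injective.injOn)) fun v hv => ?_
  intro i
  by_contra hlt
  refine hv (X_pow_dvd_iff.1 ?_ d (not_le.1 hlt))
  exact ((X_pow_dvd_lambertTerm _).trans
    (Finset.dvd_prod_of_mem (fun i => lambertTerm ℤ (v.1 i)) (Finset.mem_univ i))).mul_left _

theorem hasSum_monotoneTupleGE_succ {k n : ℕ} {g s : ℕ → ℤ⟦X⟧} {S : ℤ⟦X⟧}
    (hs : ∀ j, HasSum (fun w : MonotoneTupleGE k (n + j) => ∏ i, lambertTerm ℤ (w.1 i)) (s j))
    (hS : HasSum (fun j => g (n + j) * lambertTerm ℤ (n + j) * s j) S) :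
    HasSum (fun v : MonotoneTupleGE (k + 1) n => g (v.1 0) * ∏ i, lambertTerm ℤ (v.1 i)) S := by
  have h1 := (summable_prod_lambertTerm k n g).hasSum
  have h2 := ((sigmaEquivMonotoneTupleGE k n).hasSum_iff.2 h1).sigma
    (g := fun j => g (n + j) * lambertTerm ℤ (n + j) * s j) fun j => by
      refine ((hs j).mul_left (g (n + j) * lambertTerm ℤ (n + j))).congr_fun fun w => ?_
      rw [Function.comp_apply, coe_sigmaEquivMonotoneTupleGE, Fin.prod_univ_succ]
      simp only [Fin.cons_zero, Fin.cons_succ, mul_assoc]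
  rwa [h2.unique hS] at h1

/-- The moments of a tail of the crank product are the complete homogeneous symmetric functions
of the `q ^ j / (1 - q ^ j) ^ 2`. -/
theorem hasSum_prod_lambertTerm (k n : ℕ) :
    HasSum (fun v : MonotoneTupleGE k (n + 1) => ∏ i, lambertTerm ℤ (v.1 i))
      (momentSeries k (laurentCrankTail n)) := by
  induction k generalizing n with
  | zero =>
    have : Unique (MonotoneTupleGE 0 (n + 1)) :=
      { default := ⟨Fin.elim0, fun i => i.elim0, fun i => i.elim0⟩
        uniq := fun v => Subtype.ext (Subsingleton.elim _ _) }
    rw [momentSeries_zero_laurentCrankTail]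
    simp
  | succ k ih =>
    refine (hasSum_monotoneTupleGE_succ (g := fun _ => 1) (fun j => ?_)
      (hasSum_momentSeries_succ_laurentCrankTail k n)).congr_fun fun v => (one_mul _).symm
    rw [add_right_comm]
    exact ih (n + j)

theorem psDiv_X_pow_sum_eq {k : ℕ} {v : Fin k → ℕ} (hv : ∀ i, 1 ≤ v i) :
    psDiv (X ^ ∑ i, v i) (∏ i, (1 - X ^ v i) ^ 2) = ∏ i, lambertTerm ℤ (v i) := by
  have h1 : ∀ i, v i ≠ 0 := fun i => Nat.one_le_iff_ne_zero.1 (hv i)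
  refine psDiv_eq_of_eq_mul ?_ ?_
  · rw [map_prod]
    exact Finset.prod_eq_one fun i _ => by
      rw [map_pow, constantCoeff_one_sub (dvd_pow_self _ (h1 i)), one_pow]
  · rw [← Finset.prod_mul_distrib, ← Finset.prod_pow_eq_pow_sum]
    exact Finset.prod_congr rfl fun i _ => (lambertTerm_mul (h1 i)).symm

/-! ### Nonnegativity -/

/-- Dividing by `1 - t`, where `t` has nonnegative coefficients and no constant term, preserves
nonnegativity of the coefficients up to a given degree. -/
theorem coeff_nonneg_of_mul_one_sub {f h t : ℤ⟦X⟧} {d : ℕ} (ht : ∀ n, 0 ≤ coeff n t) (hX : X ∣ t)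
    (H : h * (1 - t) = f) (hf : ∀ n ≤ d, 0 ≤ coeff n f) : ∀ n ≤ d, 0 ≤ coeff n h := by
  intro n
  induction n using Nat.strong_induction_on with
  | _ n ih =>
    intro hn
    have h1 : h = f + h * t := by linear_combination H
    rw [h1, map_add, coeff_mul]
    refine add_nonneg (hf n hn) (Finset.sum_nonneg fun p hp => ?_)
    rw [Finset.HasAntidiagonal.mem_antidiagonal] at hp
    rcases Nat.eq_zero_or_pos p.2 with h0 | h0
    · rw [h0, coeff_zero_eq_constantCoeff_apply, X_dvd_iff.1 hX, mul_zero]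
    · exact mul_nonneg (ih p.1 (by omega) (by omega)) (ht _)

theorem coeff_mul_nonneg {f g : ℤ⟦X⟧} {d : ℕ} (hf : ∀ n ≤ d, 0 ≤ coeff n f)
    (hg : ∀ n ≤ d, 0 ≤ coeff n g) : ∀ n ≤ d, 0 ≤ coeff n (f * g) := by
  intro n hn
  rw [coeff_mul]
  refine Finset.sum_nonneg fun p hp => ?_
  rw [Finset.HasAntidiagonal.mem_antidiagonal] at hp
  exact mul_nonneg (hf _ (by omega)) (hg _ (by omega))

theorem coeff_X_pow_nonneg (m n : ℕ) : 0 ≤ coeff n (X ^ m : ℤ⟦X⟧) := by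
  rw [coeff_X_pow]
  split_ifs <;> simp

theorem coeff_lambertTerm_nonneg {m : ℕ} (hm : m ≠ 0) (n : ℕ) :
    0 ≤ coeff n (lambertTerm ℤ m) := by
  have hX : (X : ℤ⟦X⟧) ∣ X ^ m := dvd_pow_self _ hm
  have h1 : lambertTerm ℤ m * (1 - X ^ m) * (1 - X ^ m) = X ^ m := by
    rw [mul_assoc, ← sq, lambertTerm_mul hm]
  have h2 := coeff_nonneg_of_mul_one_sub (d := n) (coeff_X_pow_nonneg m) hX h1
    fun n _ => coeff_X_pow_nonneg m n
  exact coeff_nonneg_of_mul_one_sub (coeff_X_pow_nonneg m) hX rfl h2 n le_rfl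

theorem overTail_mul_one_sub (n : ℕ) :
    overTail ℤ n * (1 - X ^ (n + 1)) = (1 + X ^ (n + 1)) * overTail ℤ (n + 1) := by
  have hX : ∀ n, (X : ℤ⟦X⟧) ∣ X ^ (n + 1) := fun n => dvd_pow_self _ n.succ_ne_zero
  have c3 := constantCoeff_qPochInf (hX n)
  have c4 := constantCoeff_qPochInf (hX (n + 1))
  have e1 := qPochInf_eq_mul (X ^ (n + 1) : ℤ⟦X⟧)
  have e2 := qPochInf_eq_mul (-X ^ (n + 1) : ℤ⟦X⟧)
  rw [neg_mul, ← pow_succ] at e2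
  rw [← pow_succ] at e1
  have g1 : overTail ℤ n * qPochInf (X ^ (n + 1)) = qPochInf (-X ^ (n + 1)) :=
    psDiv_mul_cancel _ c3
  have g2 : overTail ℤ (n + 1) * qPochInf (X ^ (n + 1 + 1)) = qPochInf (-X ^ (n + 1 + 1)) :=
    psDiv_mul_cancel _ c4
  refine (isUnit_of_constantCoeff_eq_one c4).mul_right_cancel ?_
  rw [e1, e2] at g1
  linear_combination g1 - (1 + X ^ (n + 1)) * g2

theorem coeff_overTail_nonneg (m d : ℕ) : 0 ≤ coeff d (overTail ℤ m) := by
  -- The coefficients up to degree `d` are those of `1` as soon as `d ≤ m`.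
  have key : ∀ r m, d ≤ m + r → ∀ n ≤ d, 0 ≤ coeff n (overTail ℤ m) := by
    intro r
    induction r with
    | zero =>
      intro m hm n hn
      have h1 := X_pow_dvd_iff.1 (X_pow_dvd_overTail_sub_one (R := ℤ) m) n (by omega)
      rw [map_sub, sub_eq_zero] at h1
      rw [h1, coeff_one]
      split_ifs <;> simp
    | succ r ih =>
      intro m hm
      refine coeff_nonneg_of_mul_one_sub (coeff_X_pow_nonneg (m + 1))
        (dvd_pow_self _ m.succ_ne_zero) (overTail_mul_one_sub m) (coeff_mul_nonneg
          (fun n _ => ?_) (ih (m + 1) (by omega)))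
      rw [map_add]
      refine add_nonneg ?_ (coeff_X_pow_nonneg _ _)
      simpa using coeff_X_pow_nonneg 0 n
  exact key d m (by omega) d le_rfl

/-! ### The higher order smallest parts functions -/

/-- The generating function of `spt̄_k` as a single series: the moment of order `2 k` of the
difference of the crank and rank series. -/
theorem hasSum_sptBar (k : ℕ) :
    HasSum (fun j => overTail ℤ (1 + j) * lambertTerm ℤ (1 + j) *
        momentSeries k (laurentCrankTail j))
      (PowerSeries.mk fun n => if n = 0 then 0 else sptBar (k + 1) n) := by
  obtain ⟨S, hS, -⟩ := exists_hasSum_rankTerm_heineTerm C_T_mul_C_T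
  have hrank : rankSeries (LaurentPolynomial.T 1 : ℤ[T;T⁻¹]) (LaurentPolynomial.T (-1)) =
      1 + 2 * S := by
    have h1 := (hS.mul_left 2).unique (hasSum_rankTerm (z := (LaurentPolynomial.T 1 : ℤ[T;T⁻¹]))
      (by rw [← LaurentPolynomial.T_add]; simp))
    rw [h1]
    ring
  have h2 := hasSum_overTail_mul_crankTail_sub C_T_mul_C_T hS
  rw [← hrank] at h2
  -- The constant coefficients in `q` of the crank and rank series cancel.
  have hX : (X : ℤ[T;T⁻¹]⟦X⟧) ^ 1 ∣ residualCrankSeries -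
      rankSeries (LaurentPolynomial.T 1 : ℤ[T;T⁻¹]) (LaurentPolynomial.T (-1)) := by
    rw [residualCrankSeries_eq]
    refine X_pow_dvd_of_hasSum h2 fun n => Dvd.dvd.mul_left ?_ _
    rw [crankTail_sub_succ C_T_mul_C_T]
    exact (((pow_dvd_pow X (by omega)).trans
      (X_pow_dvd_lambertTerm (n + 1))).mul_left _).mul_right _
  have h3 := hasSum_momentSeries (k + 1) h2
  have h4 : PowerSeries.mk (fun n => if n = 0 then 0 else sptBar (k + 1) n) =
      momentSeries (k + 1) (residualCrankSeries -
        rankSeries (LaurentPolynomial.T 1 : ℤ[T;T⁻¹]) (LaurentPolynomial.T (-1))) := by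
    ext n
    rw [coeff_mk]
    split_ifs with hn
    · rw [hn, X_pow_dvd_iff.1 (X_pow_dvd_momentSeries _ hX) 0 one_pos]
    · rw [coeff_momentSeries, map_sub, map_sub, sptBar, overMu, overEta]
      simp_rw [← coeff_rankSeries_T]
      rfl
  rw [h4, residualCrankSeries_eq]
  refine h3.congr_fun fun j => ?_
  rw [add_comm 1 j, ← momentSeries_map_mul_sub_succ, map_overTail]
  rfl

theorem mainTheorem2 (k : ℕ) (hk : 1 ≤ k) :
    HasSum
      (fun v : PosMonotoneTuple k =>
        psDiv (X ^ (∑ i, v.1 i)) (∏ i, (1 - X ^ v.1 i) ^ 2) *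
          psDiv (qPochInf (-X ^ (v.1 ⟨0, hk⟩ + 1))) (qPochInf (X ^ (v.1 ⟨0, hk⟩ + 1))))
      (PowerSeries.mk fun n => if n = 0 then 0 else sptBar k n : ℤ⟦X⟧) ∧
    ∀ n : ℕ, 1 ≤ n → 0 ≤ sptBar k n := by
  obtain ⟨k, rfl⟩ := Nat.exists_eq_add_of_le' hk
  have hmain : HasSum (fun v : PosMonotoneTuple (k + 1) =>
      overTail ℤ (v.1 0) * ∏ i, lambertTerm ℤ (v.1 i))
      (PowerSeries.mk fun n => if n = 0 then 0 else sptBar (k + 1) n : ℤ⟦X⟧) :=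
    hasSum_monotoneTupleGE_succ (fun j => by
      rw [add_comm 1 j]
      exact hasSum_prod_lambertTerm k j) (hasSum_sptBar k)
  refine ⟨hmain.congr_fun fun v => ?_, fun n hn => ?_⟩
  · rw [psDiv_X_pow_sum_eq v.2.2, mul_comm]
    rfl
  · have h1 := (WithPiTopology.hasSum_iff_hasSum_coeff ℤ).1 hmain n
    rw [coeff_mk, if_neg (by omega)] at h1
    refine h1.nonneg fun v => ?_
    refine coeff_mul_nonneg (fun m _ => coeff_overTail_nonneg _ m) (fun m _ => ?_) n le_rfl
    refine Finset.prod_induction _ (fun f : ℤ⟦X⟧ => ∀ m, 0 ≤ coeff m f) (fun f g hf hg m =>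
      coeff_mul_nonneg (fun m _ => hf m) (fun m _ => hg m) m le_rfl) (fun m => ?_)
      (fun i _ m => coeff_lambertTerm_nonneg (Nat.one_le_iff_ne_zero.1 (v.2.2 i)) m) m
    simpa using coeff_X_pow_nonneg 0 m
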